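/- **Chi-square contraction lower bound for uniformity testing with private-coin protocols.** *Setting.* Let $k\ge 2$ be even and let $\mathcal Y$ be a finite set. A channel is a map $W$ assigning to each $x\in[k]=\{1,\dots,k\}$ a probability distribution $W(\cdot\mid x)$ on $\mathcal Y$. Let $\mathcal W$ be an arbitrary family of such channels and $\overline{\mathcal W}$ its convex hull. For a channel $W$ let $H(W)$ be the $\frac k2\times\frac k2$ positive semidefinite matrix $$H(W)_{i_1,i_2}=\sum_{y\in\mathcal Y}\frac{\bigl(W(y\mid 2i_1-1)-W(y\mid 2i_1)\bigr)\bigl(W(y\mid 2i_2-1)-W(y\mid 2i_2)\bigr)}{\sum_{x\in[k]}W(y\mid x)}$$ (terms with zero denominator are read as $0$), and let $\|\cdot\|_*$ be the nuclear norm, i.e. the sum of the singular values. In a *private-coin protocol* with $n$ players using $\mathcal W$, there are independent samples $X_1,\dots,X_n$ from an unknown distribution $p$ on $[k]$ and independent random seeds $U_1,\dots,U_n$, jointly independent of the samples. Player $i$ selects a channel $W_i\in\mathcal W$ as a function of $U_i$ and sends a message $Y_i\in\mathcal Y$ drawn from $W_i(\cdot\mid X_i)$, the messages being conditionally independent given all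 samples and seeds. A referee sees $(Y_1,\dots,Y_n)$ only (not the seeds), and outputs $T(Y_1,\dots,Y_n)\in\{0,1\}$, where $T$ is a possibly randomized map. This is an $(n,\varepsilon)$-*uniformity test using $\mathcal W$* if $\Pr[T=1]>\frac{11}{12}$ when $p$ is the uniform distribution $u$ on $[k]$, and $\Pr[T=0]>\frac{11}{12}$ for every $p$ with $d_{\rm TV}(p,u)=\frac12\sum_x|p(x)-u(x)|>\varepsilon$. The *sample complexity of $(k,\varepsilon)$-uniformity testing using $\mathcal W$ for private-coin protocols* is the least $n$ for which such a test exists ($\infty$ if there is none). *Statement.* There is a universal constant $c>0$ such that for all even $k\ge 2$, all finite $\mathcal Y$, all families $\mathcal W$ of channels from $[k]$ to $\mathcal Y$, and all $0<\varepsilon<\frac1{12\sqrt2}$, this sample complexity is at least $$c\cdot\frac{\sqrt k}{\varepsilon^2}\cdot\frac{k}{\sup_{W\in\overline{\mathcal W}}\|H(W)\|_*}$$ (read as $\infty$ when the supremum is $0$). -/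

import Mathlib

universe v w

open MeasureTheory
open scoped ENNReal

namespace PrivateCoin

noncomputable section

/-- `W` is a channel from `[k]` to the finite alphabet `Y`; `W x y` stands for `W(y ∣ x)`. -/
def IsChannel {k : ℕ} {Y : Type v} [Fintype Y] (W : Fin k → Y → ℝ) : Prop :=
  ∀ x, W x ∈ stdSimplex ℝ Y

/-- The uniform distribution on `[k]`. -/
def uniform (k : ℕ) : Fin k → ℝ := fun _ => 1 / (k : ℝ)

/-- Total variation distance between two distributions on `[k]`. -/
def tvDist {k : ℕ} (p q : Fin k → ℝ) : ℝ := (1 / 2) * ∑ x, |p x - q x|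

/-- The first element `2i - 1` of the `i`-th pair (`2 * i` when counting from zero). -/
def pairFst {k : ℕ} (i : Fin (k / 2)) : Fin k := ⟨2 * i.1, by have := i.2; omega⟩

/-- The second element `2i` of the `i`-th pair (`2 * i + 1` when counting from zero). -/
def pairSnd {k : ℕ} (i : Fin (k / 2)) : Fin k := ⟨2 * i.1 + 1, by have := i.2; omega⟩

/-- The matrix `H(W)`. A letter `y` that is never output contributes `0`, by `0 / 0 = 0`. -/
def H {k : ℕ} {Y : Type v} [Fintype Y] (W : Fin k → Y → ℝ) :
    Matrix (Fin (k / 2)) (Fin (k / 2)) ℝ :=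
  Matrix.of fun i j =>
    ∑ y, (W (pairFst i) y - W (pairSnd i) y) * (W (pairFst j) y - W (pairSnd j) y) / ∑ x, W x y

/-- The nuclear norm: the sum of the singular values, i.e. of the square roots of the eigenvalues
of `Aᴴ * A` (the conjugate transpose is the transpose over `ℝ`). -/
def nuclearNorm {m n : ℕ} (A : Matrix (Fin m) (Fin n) ℝ) : ℝ :=
  ∑ i, Real.sqrt ((Matrix.isHermitian_conjTranspose_mul_self A).eigenvalues i)

/-- A private-coin simultaneous-message-passing protocol with `n` players using the channel family
`𝓦`: player `i` holds a private random seed, with law `μ i` on its own probability space `Ω i`, and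
selects its channel in `𝓦` as a (measurable) function of that seed. -/
structure Protocol {k : ℕ} {Y : Type v} (𝓦 : Set (Fin k → Y → ℝ)) (n : ℕ) where
  Ω : Fin n → Type w
  [mΩ : ∀ i, MeasurableSpace (Ω i)]
  μ : ∀ i, Measure (Ω i)
  [isProb : ∀ i, IsProbabilityMeasure (μ i)]
  channel : ∀ i, Ω i → Fin k → Y → ℝ
  channel_mem : ∀ i u, channel i u ∈ 𝓦
  measurable_channel : ∀ i x y, Measurable fun u => channel i u x y

attribute [instance] Protocol.mΩ Protocol.isProb

/-- The probability that the players send the messages `y = (y₁, …, yₙ)`, when the samples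
`x₁, …, xₙ` are i.i.d. from `p`, the seeds are jointly independent of each other and of the
samples, and, given seeds and samples, the messages are drawn independently from
`channel i (uᵢ) (· ∣ xᵢ)`. -/
def Protocol.messageProb {k : ℕ} {Y : Type v} {𝓦 : Set (Fin k → Y → ℝ)} {n : ℕ}
    (P : Protocol.{v, w} 𝓦 n) (p : Fin k → ℝ) (y : Fin n → Y) : ℝ :=
  ∑ x : Fin n → Fin k,
    (∏ i, p (x i)) * ∫ u, ∏ i, P.channel i (u i) (x i) (y i) ∂(Measure.pi P.μ)

/-- `(P, T)` is an `(n, ε)`-test for uniformity. The referee, who sees the messages `y` only, uses a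
randomized decision rule: it outputs `1` (accept) with probability `T y` and `0` (reject) with
probability `1 - T y`. -/
def IsUniformityTest {k : ℕ} {Y : Type v} [Fintype Y] {𝓦 : Set (Fin k → Y → ℝ)} {n : ℕ}
    (ε : ℝ) (P : Protocol.{v, w} 𝓦 n) (T : (Fin n → Y) → ℝ) : Prop :=
  (∀ y, T y ∈ Set.Icc (0 : ℝ) 1) ∧
  11 / 12 < ∑ y, P.messageProb (uniform k) y * T y ∧
  ∀ p ∈ stdSimplex ℝ (Fin k), ε < tvDist p (uniform k) →
    11 / 12 < ∑ y, P.messageProb p y * (1 - T y)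

/-- The sample complexity of `(k, ε)`-uniformity testing using `𝓦` for private-coin protocols: the
least `n` for which an `(n, ε)`-test exists, and `⊤` if there is no such `n`. -/
def sampleComplexity {k : ℕ} {Y : Type v} [Fintype Y] (𝓦 : Set (Fin k → Y → ℝ)) (ε : ℝ) : ℕ∞ :=
  ⨅ (n : ℕ) (_ : ∃ (P : Protocol.{v, w} 𝓦 n) (T : (Fin n → Y) → ℝ), IsUniformityTest ε P T), (n : ℕ∞)

/-- The maximum (supremum) of `‖H(W)‖_*` over the convex hull of `𝓦`. -/
def maxNuclear {k : ℕ} {Y : Type v} [Fintype Y] (𝓦 : Set (Fin k → Y → ℝ)) : ℝ≥0∞ :=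
  ⨆ W ∈ convexHull ℝ 𝓦, ENNReal.ofReal (nuclearNorm (H W))

end

end PrivateCoin

namespace PrivateCoin

/-! ### Moments of uniform random sign vectors. -/

section Signs

/-! Private seeds are independent and unseen by the referee, so the messages are independent and
player `i` may be replaced by its average channel `W i`. Being fixed, these channels allow a hard
prior tailored to them. Put `A = ∑ i, H (W i)` and `m = k / 2`. For perturbations `p_X` of uniform
by `γ X` with `X` in the cube, Ingster's method bounds one plus the chi-square divergence of the
mixture from uniform by `E exp (γ² / k * ⟪X, A X'⟫)`, with `X'` an independent copy of `X`.

Only the trace of `A` is controlled, and a few eigenvalues may be huge. Discarding the eigenvectors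
with eigenvalue above `8 τ / m` costs at most `m / 8` dimensions and leaves a subspace `L` where `A`
is well bounded (`exists_submodule_norm_mulVec_le`). Independent signs need not lie in `L`; a random
walk inside `L` that freezes coordinates near the boundary of the cube, as in discrepancy theory,
yields a sub-Gaussian `X` in `L` with `E ‖X‖² ≥ m / 2` (`exists_subgaussian_of_finrank_ge`). If the
trace of `A` is below a small multiple of `k √k / ε²`, the divergence is too small for a test,
although `p_X` is far from uniform with substantial probability (`le_sum_trace_H_of_test`).

Finally, `W ↦ (H W).trace` is convex, so its value at an average channel is at most its value at
some channel of the family, hence at most a nuclear norm (`exists_trace_H_meanChannel_le`,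
`trace_le_nuclearNorm`). -/

lemma sum_pi_prod {ι : Type*} [Fintype ι] [DecidableEq ι] {κ : Type*} [Fintype κ]
    (f : ι → κ → ℝ) : ∑ z : ι → κ, ∏ i, f i (z i) = ∏ i, ∑ y, f i y := by
  have h := Finset.prod_univ_sum (fun _ : ι => (Finset.univ : Finset κ)) f
  rw [Fintype.piFinset_univ] at h
  exact h.symm

variable {ι : Type v} [Fintype ι] [DecidableEq ι]

/-- The real sign encoded by a Boolean. -/
def boolSign (b : Bool) : ℝ := if b then 1 else -1

/-- The vector of signs encoded by a family of Booleans. -/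
noncomputable def signVec (z : ι → Bool) : EuclideanSpace ℝ ι :=
  WithLp.toLp 2 fun i => boolSign (z i)

omit [Fintype ι] [DecidableEq ι] in
lemma signVec_apply (z : ι → Bool) (i : ι) : signVec z i = boolSign (z i) := rfl

lemma sum_bool_prod (g : ι → Bool → ℝ) :
    ∑ z : ι → Bool, ∏ i, g i (z i) = ∏ i, (g i true + g i false) := by
  simp [sum_pi_prod]

lemma sum_boolSign_mul_boolSign (i j : ι) :
    ∑ z : ι → Bool, (1 / 2 : ℝ) ^ Fintype.card ι * (boolSign (z i) * boolSign (z j)) =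
      if i = j then 1 else 0 := by
  -- Padding with factors `1` makes the integrand a product over all coordinates, so the expectation
  -- factorizes.
  have h := sum_bool_prod fun (l : ι) (b : Bool) =>
    (1 / 2 : ℝ) * ((if l = i then boolSign b else 1) * (if l = j then boolSign b else 1))
  simp only [Finset.prod_mul_distrib, Finset.prod_ite_eq', Finset.mem_univ, if_true,
    Finset.prod_const, Finset.card_univ] at h
  rw [h]
  split_ifs with hij
  · subst hij
    refine Finset.prod_eq_one fun l _ => ?_
    by_cases hl : l = i <;> simp [hl, boolSign] <;> norm_num
  · refine Finset.prod_eq_zero (Finset.mem_univ i) ?_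
    simp [hij, boolSign]

lemma sum_boolSign (i : ι) :
    ∑ z : ι → Bool, (1 / 2 : ℝ) ^ Fintype.card ι * boolSign (z i) = 0 := by
  have h := sum_bool_prod fun (l : ι) (b : Bool) =>
    (1 / 2 : ℝ) * (if l = i then boolSign b else 1)
  simp only [Finset.prod_mul_distrib, Finset.prod_ite_eq', Finset.mem_univ, if_true,
    Finset.prod_const, Finset.card_univ] at h
  rw [h]
  refine Finset.prod_eq_zero (Finset.mem_univ i) ?_
  simp [boolSign]

lemma sum_half_pow_card : ∑ _z : ι → Bool, (1 / 2 : ℝ) ^ Fintype.card ι = 1 := by simp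

/-- Hoeffding's bound: coordinates are independent, and each contributes `cosh (v l) ≤ exp (v l ^ 2
/ 2)`. -/
lemma sum_exp_inner_signVec_le (v : EuclideanSpace ℝ ι) :
    ∑ z : ι → Bool, (1 / 2 : ℝ) ^ Fintype.card ι * Real.exp (inner ℝ (signVec z) v) ≤
      Real.exp (‖v‖ ^ 2 / 2) := by
  have h := sum_bool_prod fun (l : ι) (b : Bool) => (1 / 2 : ℝ) * Real.exp (boolSign b * v l)
  simp only [Finset.prod_mul_distrib, Finset.prod_const, Finset.card_univ, ← Real.exp_sum] at h
  have hin : ∀ z : ι → Bool, inner ℝ (signVec z) v = ∑ l, boolSign (z l) * v l := fun z => by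
    simp [PiLp.inner_apply, signVec_apply, mul_comm]
  simp only [hin]
  rw [h, EuclideanSpace.real_norm_sq_eq, Finset.sum_div, Real.exp_sum]
  refine Finset.prod_le_prod (fun l _ => by positivity) fun l _ => ?_
  refine le_trans (le_of_eq ?_) (Real.cosh_le_exp_half_sq (v l))
  rw [Real.cosh_eq]
  simp [boolSign]
  ring

lemma sum_inner_signVec (v : EuclideanSpace ℝ ι) :
    ∑ z : ι → Bool, (1 / 2 : ℝ) ^ Fintype.card ι * inner ℝ (signVec z) v = 0 := by
  have hin : ∀ z : ι → Bool, inner ℝ (signVec z) v = ∑ l, boolSign (z l) * v l := fun z => by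
    simp [PiLp.inner_apply, signVec_apply, mul_comm]
  simp only [hin, Finset.mul_sum]
  rw [Finset.sum_comm]
  refine Finset.sum_eq_zero fun l _ => ?_
  simp only [← mul_assoc]
  rw [← Finset.sum_mul, sum_boolSign, zero_mul]

/-- A random sign vector has identity covariance. Applied to a projection, this makes the dimension
of its range the variance of a step of the walk. -/
lemma sum_inner_signVec_map (T : EuclideanSpace ℝ ι →ₗ[ℝ] EuclideanSpace ℝ ι) :
    ∑ z : ι → Bool, (1 / 2 : ℝ) ^ Fintype.card ι * inner ℝ (signVec z) (T (signVec z)) =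
      LinearMap.trace ℝ _ T := by
  set b := EuclideanSpace.basisFun ι ℝ
  have hz : ∀ z : ι → Bool, signVec z = ∑ i, boolSign (z i) • b i := fun z => by
    have := b.sum_repr (signVec z)
    simpa [b, signVec_apply] using this.symm
  have hin : ∀ z : ι → Bool, inner ℝ (signVec z) (T (signVec z)) =
      ∑ i, ∑ j, boolSign (z i) * boolSign (z j) * inner ℝ (b i) (T (b j)) := fun z => by
    rw [hz]
    simp only [map_sum, map_smul, sum_inner, inner_sum, inner_smul_left, inner_smul_right]
    rw [Finset.sum_comm]
    simp only [Finset.mul_sum]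
    refine Finset.sum_congr rfl fun i _ => Finset.sum_congr rfl fun j _ => ?_
    simp
    ring
  rw [LinearMap.trace_eq_sum_inner T b]
  simp only [hin, Finset.mul_sum]
  rw [Finset.sum_comm]
  refine Finset.sum_congr rfl fun i _ => ?_
  rw [Finset.sum_comm]
  simp only [← mul_assoc]
  simp only [← Finset.sum_mul]
  simp only [mul_assoc, sum_boolSign_mul_boolSign]
  simp

omit [DecidableEq ι] in
lemma norm_signVec_sq (z : ι → Bool) : ‖signVec z‖ ^ 2 = Fintype.card ι := by
  rw [EuclideanSpace.real_norm_sq_eq]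
  have : ∀ b : Bool, boolSign b ^ 2 = 1 := fun b => by cases b <;> simp [boolSign]
  simp [signVec_apply, this]

end Signs

/-! ### A sub-Gaussian random walk in a subspace of the cube. -/

section Walk

variable {ι : Type v} [Fintype ι] [DecidableEq ι]

/-- The vectors of `L` that vanish on the coordinates where `x` is close to the boundary of the
cube. -/
noncomputable def freeSpace (L : Submodule ℝ (EuclideanSpace ℝ ι)) (x : EuclideanSpace ℝ ι) :
    Submodule ℝ (EuclideanSpace ℝ ι) :=
  L ⊓ (Submodule.span ℝ (Set.range fun i : {i // 7 / 8 < |x i|} =>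
    EuclideanSpace.basisFun ι ℝ i))ᗮ

lemma apply_eq_zero_of_mem_freeSpace {L : Submodule ℝ (EuclideanSpace ℝ ι)}
    {x y : EuclideanSpace ℝ ι} (hy : y ∈ freeSpace L x) {i : ι} (hi : 7 / 8 < |x i|) :
    y i = 0 := by
  have h := (Submodule.mem_orthogonal _ _).1 hy.2 (EuclideanSpace.basisFun ι ℝ i)
    (Submodule.subset_span ⟨⟨i, hi⟩, rfl⟩)
  simpa [EuclideanSpace.inner_single_left] using h

omit [DecidableEq ι] in
-- Each frozen coordinate costs at most one dimension and contributes at least `49 / 64` to `‖x‖ ^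
-- 2`.
lemma finrank_freeSpace_ge (L : Submodule ℝ (EuclideanSpace ℝ ι)) (x : EuclideanSpace ℝ ι) :
    (Module.finrank ℝ L : ℝ) - 64 / 49 * ‖x‖ ^ 2 ≤ Module.finrank ℝ (freeSpace L x) := by
  set N := Submodule.span ℝ (Set.range fun i : {i // 7 / 8 < |x i|} =>
    EuclideanSpace.basisFun ι ℝ i)
  have h1 : Module.finrank ℝ N ≤ Fintype.card {i // 7 / 8 < |x i|} :=
    finrank_range_le_card _
  have h2 := Submodule.finrank_add_finrank_orthogonal N
  have h3 := Submodule.finrank_sup_add_finrank_inf_eq L Nᗮ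
  have h4 := Submodule.finrank_le (L ⊔ Nᗮ)
  have h5 : (Fintype.card {i // 7 / 8 < |x i|} : ℝ) ≤ 64 / 49 * ‖x‖ ^ 2 := by
    rw [EuclideanSpace.real_norm_sq_eq, Fintype.card_subtype, Finset.card_eq_sum_ones,
      Finset.mul_sum, Finset.sum_filter]
    push_cast
    refine Finset.sum_le_sum fun i _ => ?_
    split_ifs with h
    · rw [← sq_abs]
      nlinarith
    · positivity
  have h6 : Module.finrank ℝ L ≤ Module.finrank ℝ (freeSpace L x) +
      Fintype.card {i // 7 / 8 < |x i|} := by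
    change _ ≤ Module.finrank ℝ (L ⊓ Nᗮ : Submodule ℝ (EuclideanSpace ℝ ι)) + _
    omega
  have h7 : (Module.finrank ℝ L : ℝ) ≤ Module.finrank ℝ (freeSpace L x) +
      Fintype.card {i // 7 / 8 < |x i|} := by exact_mod_cast h6
  linarith

/-- One step of the walk inside `L`: a random sign vector, projected to the free space. -/
noncomputable def walkStep (L : Submodule ℝ (EuclideanSpace ℝ ι)) (η : ℝ)
    (x : EuclideanSpace ℝ ι) (z : ι → Bool) : EuclideanSpace ℝ ι :=
  x + η • (freeSpace L x).starProjection (signVec z)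

omit [DecidableEq ι] in
lemma walkStep_mem {L : Submodule ℝ (EuclideanSpace ℝ ι)} {η : ℝ} {x : EuclideanSpace ℝ ι}
    (hx : x ∈ L) (z : ι → Bool) : walkStep L η x z ∈ L :=
  L.add_mem hx (L.smul_mem _ (Submodule.starProjection_apply_mem (freeSpace L x) _).1)

lemma abs_walkStep_le {L : Submodule ℝ (EuclideanSpace ℝ ι)} {η : ℝ}
    (hη : η ^ 2 * Fintype.card ι ≤ 1 / 64) {x : EuclideanSpace ℝ ι}
    (hx : ∀ i, |x i| ≤ 1) (z : ι → Bool) (i : ι) : |walkStep L η x z i| ≤ 1 := by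
  set y := (freeSpace L x).starProjection (signVec z)
  have hy : y ∈ freeSpace L x := Submodule.starProjection_apply_mem _ _
  have hw : walkStep L η x z i = x i + η * y i := by simp [walkStep, y]
  rw [hw]
  by_cases hi : 7 / 8 < |x i|
  · rw [apply_eq_zero_of_mem_freeSpace hy hi, mul_zero, add_zero]
    exact hx i
  -- A free coordinate is at most `7 / 8` in absolute value, and the bound on `η` limits its move to
  -- `1 / 8`.
  · have h1 : |y i| ≤ ‖signVec z‖ := by
      refine le_trans ?_ ((freeSpace L x).norm_starProjection_apply_le (signVec z))
      exact PiLp.norm_apply_le y i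
    have h2 : |η * y i| ≤ 1 / 8 := by
      refine abs_le_of_sq_le_sq ?_ (by norm_num)
      rw [mul_pow, ← sq_abs (y i)]
      calc η ^ 2 * |y i| ^ 2 ≤ η ^ 2 * ‖signVec z‖ ^ 2 := by gcongr
        _ ≤ _ := by rw [norm_signVec_sq]; linarith
    calc _ ≤ |x i| + |η * y i| := abs_add_le _ _
      _ ≤ 1 := by linarith

lemma sum_exp_inner_walkStep_le (L : Submodule ℝ (EuclideanSpace ℝ ι)) (η : ℝ)
    (x v : EuclideanSpace ℝ ι) :
    ∑ z : ι → Bool, (1 / 2 : ℝ) ^ Fintype.card ι * Real.exp (inner ℝ (walkStep L η x z) v) ≤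
      Real.exp (inner ℝ x v) * Real.exp (η ^ 2 * ‖v‖ ^ 2 / 2) := by
  have h := sum_exp_inner_signVec_le (η • (freeSpace L x).starProjection v)
  have h1 : ∀ z : ι → Bool, Real.exp (inner ℝ (walkStep L η x z) v) =
      Real.exp (inner ℝ x v) *
        Real.exp (inner ℝ (signVec z) (η • (freeSpace L x).starProjection v)) := fun z => by
    rw [← Real.exp_add, walkStep, inner_add_left, inner_smul_left, inner_smul_right,
      Submodule.inner_starProjection_left_eq_right]
    simp
  simp only [h1, mul_left_comm _ (Real.exp (inner ℝ x v))]
  rw [← Finset.mul_sum]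
  gcongr
  refine h.trans (Real.exp_le_exp.2 ?_)
  rw [norm_smul, mul_pow, Real.norm_eq_abs, sq_abs]
  gcongr
  exact (freeSpace L x).norm_starProjection_apply_le v

lemma sum_norm_walkStep_sq (L : Submodule ℝ (EuclideanSpace ℝ ι)) (η : ℝ)
    (x : EuclideanSpace ℝ ι) :
    ∑ z : ι → Bool, (1 / 2 : ℝ) ^ Fintype.card ι * ‖walkStep L η x z‖ ^ 2 =
      ‖x‖ ^ 2 + η ^ 2 * Module.finrank ℝ (freeSpace L x) := by
  set P := (freeSpace L x).starProjection
  have hP : LinearMap.IsProj (freeSpace L x) P.toLinearMap :=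
    ⟨fun y => Submodule.starProjection_apply_mem _ _,
      fun y hy => Submodule.starProjection_eq_self_iff.2 hy⟩
  have hidem : ∀ y, P (P y) = P y := fun y => hP.map_id _ (hP.map_mem y)
  have h1 : ∀ z : ι → Bool, ‖walkStep L η x z‖ ^ 2 =
      ‖x‖ ^ 2 + 2 * η * inner ℝ (signVec z) (P x) +
        η ^ 2 * inner ℝ (signVec z) (P.toLinearMap (signVec z)) := fun z => by
    rw [walkStep, norm_add_sq_real, norm_smul, mul_pow, Real.norm_eq_abs, sq_abs,
      inner_smul_right, ← Submodule.inner_starProjection_left_eq_right, real_inner_comm,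
      ← real_inner_self_eq_norm_sq (P (signVec z)),
      Submodule.inner_starProjection_left_eq_right, ContinuousLinearMap.coe_coe]
    change _ + _ * inner ℝ (signVec z) (P (P (signVec z))) = _
    rw [hidem]
    ring
  have h2 := sum_inner_signVec (P x)
  have h3 := sum_inner_signVec_map P.toLinearMap
  rw [hP.trace] at h3
  have h4 := sum_half_pow_card (ι := ι)
  calc _ = ‖x‖ ^ 2 * ∑ _z : ι → Bool, (1 / 2 : ℝ) ^ Fintype.card ι +
        2 * η * (∑ z : ι → Bool, (1 / 2 : ℝ) ^ Fintype.card ι * inner ℝ (signVec z) (P x)) +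
        η ^ 2 * ∑ z : ι → Bool, (1 / 2 : ℝ) ^ Fintype.card ι *
          inner ℝ (signVec z) (P.toLinearMap (signVec z)) := by
        simp only [Finset.mul_sum, ← Finset.sum_add_distrib]
        refine Finset.sum_congr rfl fun z _ => ?_
        rw [h1]
        ring
    _ = _ := by rw [h2, h3, h4]; ring

/-- Conditionally on the past, a step multiplies the exponential moment by at most `exp (η ^ 2 * ‖v‖
^ 2 / 2)`, whatever the position, and adds `η ^ 2` times the free dimension to the second moment.
That dimension stays of order `Fintype.card ι` on average while the second moment is below half its
maximum. -/
lemma exists_walk (L : Submodule ℝ (EuclideanSpace ℝ ι))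
    (hL : 7 / 8 * (Fintype.card ι : ℝ) ≤ Module.finrank ℝ L) {η : ℝ}
    (hη : η ^ 2 * Fintype.card ι ≤ 1 / 64) (t : ℕ) :
    ∃ (Ω : Type v) (_ : Fintype Ω) (q : Ω → ℝ) (X : Ω → EuclideanSpace ℝ ι),
      (∀ ω, 0 ≤ q ω) ∧ ∑ ω, q ω = 1 ∧ (∀ ω, X ω ∈ L) ∧ (∀ ω i, |X ω i| ≤ 1) ∧
      (∀ v, ∑ ω, q ω * Real.exp (inner ℝ (X ω) v) ≤ Real.exp (t * η ^ 2 * ‖v‖ ^ 2 / 2)) ∧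
      min (1 / 2) (t * η ^ 2 / 5) * (Fintype.card ι : ℝ) ≤ ∑ ω, q ω * ‖X ω‖ ^ 2 := by
  induction t with
  | zero =>
    refine ⟨PUnit, inferInstance, fun _ => 1, fun _ => 0, ?_⟩
    simp
  | succ t ih =>
    obtain ⟨Ω, _, q, X, hq, hq1, hXL, hX1, hexp, hsq⟩ := ih
    have hprod : ∀ f : Ω × (ι → Bool) → ℝ,
        ∑ p, q p.1 * (1 / 2 : ℝ) ^ Fintype.card ι * f p =
          ∑ ω, q ω * ∑ z, (1 / 2 : ℝ) ^ Fintype.card ι * f (ω, z) := fun f => by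
      rw [Fintype.sum_prod_type]
      refine Finset.sum_congr rfl fun ω _ => ?_
      rw [Finset.mul_sum]
      exact Finset.sum_congr rfl fun z _ => by ring
    refine ⟨Ω × (ι → Bool), inferInstance,
      fun p => q p.1 * (1 / 2 : ℝ) ^ Fintype.card ι, fun p => walkStep L η (X p.1) p.2,
      fun p => mul_nonneg (hq _) (by positivity), ?_, fun p => walkStep_mem (hXL _) _,
      fun p => abs_walkStep_le hη (hX1 _) _, fun v => ?_, ?_⟩
    · rw [Fintype.sum_prod_type]
      simp only [← Finset.mul_sum, sum_half_pow_card, mul_one, hq1]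
    · rw [hprod fun p => Real.exp (inner ℝ (walkStep L η (X p.1) p.2) v)]
      calc _ ≤ ∑ ω, q ω * (Real.exp (inner ℝ (X ω) v) * Real.exp (η ^ 2 * ‖v‖ ^ 2 / 2)) :=
            Finset.sum_le_sum fun ω _ =>
              mul_le_mul_of_nonneg_left (sum_exp_inner_walkStep_le L η (X ω) v) (hq ω)
        _ = (∑ ω, q ω * Real.exp (inner ℝ (X ω) v)) * Real.exp (η ^ 2 * ‖v‖ ^ 2 / 2) := by
            rw [Finset.sum_mul]
            exact Finset.sum_congr rfl fun ω _ => by ring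
        _ ≤ Real.exp (t * η ^ 2 * ‖v‖ ^ 2 / 2) * Real.exp (η ^ 2 * ‖v‖ ^ 2 / 2) := by
            gcongr
            exact hexp v
        _ = _ := by
            rw [← Real.exp_add]
            congr 1
            push_cast
            ring
    · rw [hprod fun p => ‖walkStep L η (X p.1) p.2‖ ^ 2]
      simp only [sum_norm_walkStep_sq]
      set φ := ∑ ω, q ω * ‖X ω‖ ^ 2
      set n : ℝ := (Fintype.card ι : ℝ)
      have hn : 0 ≤ n := Nat.cast_nonneg _
      have hη0 := sq_nonneg η
      have hmono : φ ≤ ∑ ω, q ω * (‖X ω‖ ^ 2 + η ^ 2 * Module.finrank ℝ (freeSpace L (X ω))) :=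
        Finset.sum_le_sum fun ω _ => mul_le_mul_of_nonneg_left
          (le_add_of_nonneg_right (by positivity)) (hq ω)
      have hgrow : φ + η ^ 2 * (7 / 8 * n - 64 / 49 * φ) ≤
          ∑ ω, q ω * (‖X ω‖ ^ 2 + η ^ 2 * Module.finrank ℝ (freeSpace L (X ω))) := by
        calc _ = ∑ ω, (q ω * ‖X ω‖ ^ 2 +
              (q ω * (η ^ 2 * (7 / 8 * n)) - η ^ 2 * (64 / 49) * (q ω * ‖X ω‖ ^ 2))) := by
              rw [Finset.sum_add_distrib, Finset.sum_sub_distrib, ← Finset.sum_mul,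
                ← Finset.mul_sum, hq1]
              ring
          _ ≤ _ := by
              refine Finset.sum_le_sum fun ω _ => ?_
              have := finrank_freeSpace_ge L (X ω)
              have h' : 7 / 8 * n - 64 / 49 * ‖X ω‖ ^ 2 ≤ Module.finrank ℝ (freeSpace L (X ω)) := by
                linarith
              have := mul_le_mul_of_nonneg_left h' (mul_nonneg (hq ω) hη0)
              linarith
      rcases le_total (n / 2) φ with h | h
      · calc _ ≤ 1 / 2 * n := by gcongr; exact min_le_left _ _
          _ ≤ _ := by linarith
      · rcases le_total (1 / 2 : ℝ) (t * η ^ 2 / 5) with h5 | h5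
        · rw [min_eq_left h5] at hsq
          calc _ ≤ 1 / 2 * n := by gcongr; exact min_le_left _ _
            _ ≤ _ := by linarith
        · rw [min_eq_right h5] at hsq
          calc _ ≤ ((t + 1 : ℕ) : ℝ) * η ^ 2 / 5 * n := by gcongr; exact min_le_right _ _
            _ = t * η ^ 2 / 5 * n + η ^ 2 * (n / 5) := by push_cast; ring
            -- With `φ ≤ n / 2`, the average free dimension is at least `(7 / 8 - 32 / 49) * n`,
            -- which exceeds `n / 5`.
            _ ≤ φ + η ^ 2 * (7 / 8 * n - 64 / 49 * φ) := by
              gcongr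
              linarith
            _ ≤ _ := hgrow

/-- A subspace of small codimension carries a random vector of the cube that is sub-Gaussian and
has large second moment. -/
theorem exists_subgaussian_of_finrank_ge [Nonempty ι] (L : Submodule ℝ (EuclideanSpace ℝ ι))
    (hL : 7 / 8 * (Fintype.card ι : ℝ) ≤ Module.finrank ℝ L) :
    ∃ (Ω : Type v) (_ : Fintype Ω) (q : Ω → ℝ) (X : Ω → EuclideanSpace ℝ ι),
      (∀ ω, 0 ≤ q ω) ∧ ∑ ω, q ω = 1 ∧ (∀ ω, X ω ∈ L) ∧ (∀ ω i, |X ω i| ≤ 1) ∧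
      (∀ v, ∑ ω, q ω * Real.exp (inner ℝ (X ω) v) ≤ Real.exp (5 / 4 * ‖v‖ ^ 2)) ∧
      1 / 2 * (Fintype.card ι : ℝ) ≤ ∑ ω, q ω * ‖X ω‖ ^ 2 := by
  have hn : (0 : ℝ) < Fintype.card ι := by exact_mod_cast Fintype.card_pos
  have hη : (√(1 / (64 * Fintype.card ι)) : ℝ) ^ 2 = 1 / (64 * Fintype.card ι) :=
    Real.sq_sqrt (by positivity)
  -- The largest admissible step is taken, and `160 * card` steps give `t * η ^ 2 = 5 / 2`, exactly
  -- when `t * η ^ 2 / 5` reaches `1 / 2`.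
  obtain ⟨Ω, i, q, X, h1, h2, h3, h4, h5, h6⟩ :=
    exists_walk L hL (η := √(1 / (64 * Fintype.card ι))) (by rw [hη]; field_simp; rfl)
      (160 * Fintype.card ι)
  have ht : ((160 * Fintype.card ι : ℕ) : ℝ) * (√(1 / (64 * Fintype.card ι)) : ℝ) ^ 2 = 5 / 2 := by
    rw [hη]
    push_cast
    field_simp
    norm_num
  rw [ht] at h5 h6
  refine ⟨Ω, i, q, X, h1, h2, h3, h4, fun v => (h5 v).trans_eq ?_, ?_⟩
  · congr 1
    ring
  · norm_num at h6
    linarith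

end Walk

/-! ### Spectral consequences of a trace bound, and the nuclear norm. -/

section Matrices

/-- A positive semidefinite matrix of small trace contracts a subspace of small codimension. -/
theorem exists_submodule_norm_mulVec_le {ι : Type v} [Fintype ι] [DecidableEq ι] [Nonempty ι]
    {A : Matrix ι ι ℝ} (hA : A.PosSemidef) {τ : ℝ} (hτ : 0 < τ) (htr : A.trace ≤ τ) :
    ∃ L : Submodule ℝ (EuclideanSpace ℝ ι),
      7 / 8 * (Fintype.card ι : ℝ) ≤ Module.finrank ℝ L ∧
      ∀ x ∈ L, ‖Matrix.toEuclideanLin A x‖ ≤ 8 * τ / Fintype.card ι * ‖x‖ := by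
  have hn : (0 : ℝ) < Fintype.card ι := by exact_mod_cast Fintype.card_pos
  set a := 8 * τ / (Fintype.card ι : ℝ) with ha
  have ha0 : 0 < a := by positivity
  set b := hA.1.eigenvectorBasis
  set l := hA.1.eigenvalues
  have hl0 : ∀ i, 0 ≤ l i := hA.eigenvalues_nonneg
  set N := Submodule.span ℝ (Set.range fun i : {i // a < l i} => b i)
  refine ⟨Nᗮ, ?_, fun x hx => ?_⟩
  · have h1 : Module.finrank ℝ N ≤ Fintype.card {i // a < l i} := finrank_range_le_card _
    have h2 := Submodule.finrank_add_finrank_orthogonal N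
    rw [finrank_euclideanSpace] at h2
    -- Markov's inequality for the eigenvalues, whose sum is the trace.
    have h3 : a * (Fintype.card {i // a < l i} : ℝ) ≤ τ := by
      calc _ ≤ ∑ i, l i := by
            rw [Fintype.card_subtype, Finset.card_eq_sum_ones, Finset.sum_filter]
            push_cast
            rw [Finset.mul_sum]
            refine Finset.sum_le_sum fun i _ => ?_
            split_ifs with h
            · linarith
            · simpa using hl0 i
        _ = A.trace := by
            rw [hA.1.trace_eq_sum_eigenvalues]
            simp [l]
        _ ≤ τ := htr
    have h4 : (Fintype.card {i // a < l i} : ℝ) ≤ Fintype.card ι / 8 := by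
      rw [ha, div_mul_eq_mul_div, div_le_iff₀ hn] at h3
      have : τ * (8 * (Fintype.card {i // a < l i} : ℝ)) ≤ τ * Fintype.card ι := by linarith
      have := le_of_mul_le_mul_left this hτ
      linarith
    have h5 : (Fintype.card ι : ℝ) ≤ Fintype.card {i // a < l i} + Module.finrank ℝ Nᗮ := by
      exact_mod_cast (by omega : Fintype.card ι ≤ _ + _)
    linarith
  · have hb : ∀ i, inner ℝ (b i) (Matrix.toEuclideanLin A x) = l i * inner ℝ (b i) x := fun i => by
      have h1 : Matrix.toEuclideanLin A (b i) = l i • b i := by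
        ext j
        have := congrFun (hA.1.mulVec_eigenvectorBasis i) j
        simpa [Matrix.toLpLin_apply] using this
      have h2 : (Matrix.toEuclideanLin A).IsSymmetric :=
        Matrix.isSymmetric_toEuclideanLin_iff.2 hA.1
      rw [← h2, h1, inner_smul_left]
      simp
    refine abs_le_of_sq_le_sq' ?_ (by positivity) |>.2
    rw [mul_pow, ← b.sum_sq_inner_right, ← b.sum_sq_inner_right x, Finset.mul_sum]
    refine Finset.sum_le_sum fun i _ => ?_
    rw [hb]
    by_cases h : a < l i
    · have : inner ℝ (b i) x = 0 :=
        (Submodule.mem_orthogonal _ _).1 hx _ (Submodule.subset_span ⟨⟨i, h⟩, rfl⟩)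
      simp [this]
    · rw [mul_pow]
      have := hl0 i
      gcongr
      exact not_lt.1 h

/-- The trace is at most the nuclear norm. -/
theorem trace_le_nuclearNorm {n : ℕ} (A : Matrix (Fin n) (Fin n) ℝ) :
    A.trace ≤ nuclearNorm A := by
  set h := Matrix.isHermitian_conjTranspose_mul_self A
  -- In a basis of right singular vectors, each diagonal entry `⟪b i, A (b i)⟫` is at most `‖A (b
  -- i)‖`, which is the singular value.
  set b := h.eigenvectorBasis
  have ht : A.trace = ∑ i, inner ℝ (b i) (Matrix.toEuclideanLin A (b i)) := by
    rw [← LinearMap.trace_eq_sum_inner,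
      LinearMap.trace_eq_sum_inner _ (EuclideanSpace.basisFun (Fin n) ℝ)]
    simp [Matrix.trace, EuclideanSpace.inner_single_left, Matrix.toLpLin_apply]
  rw [ht, nuclearNorm]
  refine Finset.sum_le_sum fun i _ => ?_
  have h1 : ‖b i‖ = 1 := b.norm_eq_one i
  refine (real_inner_le_norm _ _).trans ?_
  rw [h1, one_mul]
  refine Real.le_sqrt_of_sq_le (le_of_eq ?_)
  have h2 := congrArg (fun v => dotProduct (b i).ofLp v) (h.mulVec_eigenvectorBasis i)
  have h3 : dotProduct (b i).ofLp (b i).ofLp = 1 := by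
    have := EuclideanSpace.real_norm_sq_eq (b i)
    rw [h1, one_pow] at this
    simpa only [dotProduct, sq] using this.symm
  have h4 : Matrix.vecMul (b i).ofLp A.conjTranspose = A.mulVec (b i).ofLp := by
    rw [Matrix.conjTranspose_eq_transpose_of_trivial, Matrix.vecMul_transpose]
  change (b i).ofLp ⬝ᵥ (A.conjTranspose * A).mulVec (b i).ofLp =
    (b i).ofLp ⬝ᵥ (h.eigenvalues i • (b i).ofLp) at h2
  rw [dotProduct_smul, h3, ← Matrix.mulVec_mulVec, Matrix.dotProduct_mulVec, h4] at h2
  rw [EuclideanSpace.real_norm_sq_eq]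
  simpa [dotProduct, sq, Matrix.toLpLin_apply] using h2

end Matrices

/-! ### The matrix `H` and convexity of its trace. -/

section Trace

variable {k : ℕ} {Y : Type v} [Fintype Y]

lemma channel_nonneg {W : Fin k → Y → ℝ} (hW : IsChannel W) (x : Fin k) (y : Y) : 0 ≤ W x y :=
  (hW x).1 y

lemma channel_le_one {W : Fin k → Y → ℝ} (hW : IsChannel W) (x : Fin k) (y : Y) : W x y ≤ 1 := by
  rw [← (hW x).2]
  exact Finset.single_le_sum (fun y _ => (hW x).1 y) (Finset.mem_univ y)

lemma channel_eq_zero_of_sum_eq_zero {W : Fin k → Y → ℝ} (hW : IsChannel W) {y : Y}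
    (h : ∑ x, W x y = 0) (x : Fin k) : W x y = 0 :=
  (Finset.sum_eq_zero_iff_of_nonneg fun x _ => channel_nonneg hW x y).1 h x (Finset.mem_univ x)

lemma dotProduct_H_mulVec (W : Fin k → Y → ℝ) (x x' : Fin (k / 2) → ℝ) :
    x ⬝ᵥ (H W).mulVec x' =
      ∑ y, (∑ i, x i * (W (pairFst i) y - W (pairSnd i) y)) *
        (∑ i, x' i * (W (pairFst i) y - W (pairSnd i) y)) / ∑ x, W x y := by
  simp only [dotProduct, Matrix.mulVec, H, Matrix.of_apply, Finset.sum_mul, Finset.mul_sum,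
    Finset.sum_div]
  conv_rhs => rw [Finset.sum_comm]
  conv_lhs => rw [Finset.sum_comm]
  refine Finset.sum_congr rfl fun j _ => ?_
  rw [Finset.sum_comm]
  refine Finset.sum_congr rfl fun y _ => Finset.sum_congr rfl fun i _ => ?_
  ring

lemma H_posSemidef {W : Fin k → Y → ℝ} (hW : IsChannel W) : (H W).PosSemidef := by
  refine Matrix.PosSemidef.of_dotProduct_mulVec_nonneg ?_ fun x => ?_
  · ext i j
    simp only [H, Matrix.conjTranspose_apply, Matrix.of_apply, star_trivial]
    exact Finset.sum_congr rfl fun y _ => by ring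
  · rw [star_trivial, dotProduct_H_mulVec]
    exact Finset.sum_nonneg fun y _ => div_nonneg (mul_self_nonneg _)
      (Finset.sum_nonneg fun x _ => channel_nonneg hW x y)

lemma trace_H (W : Fin k → Y → ℝ) :
    (H W).trace = ∑ y, ∑ i, (W (pairFst i) y - W (pairSnd i) y) ^ 2 / ∑ x, W x y := by
  rw [Finset.sum_comm]
  simp [Matrix.trace, H, sq]

/-- Tangent bound for the convex function `a ^ 2 / b`: the left side is linear in `(a, b)`, with
equality at `t = a / b`. -/
lemma two_mul_mul_sub_le_sq_div {a b t : ℝ} (hb : 0 ≤ b) (hab : b = 0 → a = 0) :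
    2 * t * a - t ^ 2 * b ≤ a ^ 2 / b := by
  rcases hb.eq_or_lt with h | h
  · simp [← h, hab h.symm]
  · rw [le_div_iff₀ h]
    nlinarith [sq_nonneg (a - t * b)]

/-- The average of a random channel. -/
noncomputable def meanChannel {Ω : Type w} [MeasurableSpace Ω] (μ : Measure Ω)
    (V : Ω → Fin k → Y → ℝ) : Fin k → Y → ℝ := fun x y => ∫ u, V u x y ∂μ

variable {Ω : Type w} [MeasurableSpace Ω] {μ : Measure Ω} [IsProbabilityMeasure μ]
  {V : Ω → Fin k → Y → ℝ}

lemma integrable_channel (hV : ∀ u, IsChannel (V u)) (hm : ∀ x y, Measurable fun u => V u x y)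
    (x : Fin k) (y : Y) : Integrable (fun u => V u x y) μ :=
  Integrable.of_bound (hm x y).aestronglyMeasurable 1 <| Filter.Eventually.of_forall fun u => by
    rw [Real.norm_of_nonneg (channel_nonneg (hV u) x y)]
    exact channel_le_one (hV u) x y

lemma isChannel_meanChannel (hV : ∀ u, IsChannel (V u))
    (hm : ∀ x y, Measurable fun u => V u x y) : IsChannel (meanChannel μ V) := fun x =>
  ⟨fun y => integral_nonneg fun u => channel_nonneg (hV u) x y, by
    simp only [meanChannel]
    rw [← integral_finsetSum _ fun y _ => integrable_channel hV hm x y]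
    simp [(hV _ x).2]⟩

/-- By convexity, the trace of `H` at the average channel is at most its value at some channel. -/
theorem exists_trace_H_meanChannel_le (hV : ∀ u, IsChannel (V u))
    (hm : ∀ x y, Measurable fun u => V u x y) :
    ∃ u, (H (meanChannel μ V)).trace ≤ (H (V u)).trace := by
  set M := meanChannel μ V
  have hM : IsChannel M := isChannel_meanChannel hV hm
  -- The slopes tangent at `M` make `f` a minorant of the trace that is linear in the channel and
  -- has mean exactly `(H M).trace`. Some `u` attains at least this mean, so `M` itself need not be
  -- placed in the convex hull.
  set t : Fin (k / 2) → Y → ℝ := fun i y => (M (pairFst i) y - M (pairSnd i) y) / ∑ x, M x y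
  set f : Ω → ℝ := fun u => ∑ y, ∑ i,
    (2 * t i y * (V u (pairFst i) y - V u (pairSnd i) y) - t i y ^ 2 * ∑ x, V u x y)
  have hint := integrable_channel (μ := μ) hV hm
  have hi1 : ∀ i y, Integrable (fun u => 2 * t i y * (V u (pairFst i) y - V u (pairSnd i) y)) μ :=
    fun i y => ((hint _ y).sub (hint _ y)).const_mul _
  have hi2 : ∀ i y, Integrable (fun u => t i y ^ 2 * ∑ x, V u x y) μ :=
    fun i y => (integrable_finsetSum _ fun x _ => hint x y).const_mul _
  have hi3 : ∀ i y, Integrable (fun u => 2 * t i y * (V u (pairFst i) y - V u (pairSnd i) y) -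
      t i y ^ 2 * ∑ x, V u x y) μ := fun i y => (hi1 i y).sub (hi2 i y)
  have hf : Integrable f μ :=
    integrable_finsetSum _ fun y _ => integrable_finsetSum _ fun i _ => hi3 i y
  have hfM : ∫ u, f u ∂μ = (H M).trace := by
    rw [trace_H, integral_finsetSum _ fun y _ => integrable_finsetSum _ fun i _ => hi3 i y]
    refine Finset.sum_congr rfl fun y _ => ?_
    rw [integral_finsetSum _ fun i _ => hi3 i y]
    refine Finset.sum_congr rfl fun i _ => ?_
    rw [integral_sub (hi1 i y) (hi2 i y), integral_const_mul, integral_const_mul,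
      integral_sub (hint _ y) (hint _ y), integral_finsetSum _ fun x _ => hint x y]
    change 2 * t i y * (M (pairFst i) y - M (pairSnd i) y) - t i y ^ 2 * ∑ x, M x y = _
    by_cases h : ∑ x, M x y = 0
    · simp [t, h]
    · simp only [t]
      field_simp
      ring
  obtain ⟨u, hu⟩ := exists_integral_le hf
  refine ⟨u, ?_⟩
  rw [← hfM]
  refine hu.trans ?_
  rw [trace_H]
  refine Finset.sum_le_sum fun y _ => Finset.sum_le_sum fun i _ => ?_
  refine two_mul_mul_sub_le_sq_div
    (Finset.sum_nonneg fun x _ => channel_nonneg (hV u) x y) fun h => ?_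
  simp [channel_eq_zero_of_sum_eq_zero (hV u) h]

theorem ofReal_trace_H_meanChannel_le {𝓦 : Set (Fin k → Y → ℝ)} (h𝓦 : ∀ W ∈ 𝓦, IsChannel W)
    (hV : ∀ u, V u ∈ 𝓦) (hm : ∀ x y, Measurable fun u => V u x y) :
    ENNReal.ofReal (H (meanChannel μ V)).trace ≤ maxNuclear 𝓦 := by
  obtain ⟨u, hu⟩ := exists_trace_H_meanChannel_le (μ := μ) (fun u => h𝓦 _ (hV u)) hm
  refine le_trans (ENNReal.ofReal_le_ofReal (hu.trans (trace_le_nuclearNorm _))) ?_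
  exact le_iSup₂ (f := fun W (_ : W ∈ convexHull ℝ 𝓦) => ENNReal.ofReal (nuclearNorm (H W))) (V u)
    (subset_convexHull ℝ 𝓦 (hV u))

end Trace

/-! ### Distinguishing a mixture by its chi-square divergence. -/

section ChiSquare

/-- The expectation of a `[0, 1]`-valued function under a mixture is controlled by the chi-square
divergence of the mixture. -/
theorem sq_sub_le_chiSquare {Ω Z : Type*} [Fintype Ω] [Fintype Z] {q : Ω → ℝ} {P : Ω → Z → ℝ}
    {U R : Z → ℝ} (hq1 : ∑ ω, q ω = 1) (hP1 : ∀ ω, ∑ z, P ω z = 1) (hU : ∀ z, 0 ≤ U z)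
    (hU1 : ∑ z, U z = 1) (hPU : ∀ ω z, U z = 0 → P ω z = 0) (hR : ∀ z, R z ∈ Set.Icc (0 : ℝ) 1) :
    (∑ ω, q ω * ∑ z, P ω z * R z - ∑ z, U z * R z) ^ 2 ≤
      ∑ ω', q ω' * ∑ ω, q ω * ∑ z, P ω z * P ω' z / U z - 1 := by
  set B : Z → ℝ := fun z => ∑ ω, q ω * P ω z with hB
  have hB0 : ∀ z, U z = 0 → B z = 0 := fun z hz => by simp [hB, hPU _ z hz]
  have hB1 : ∑ z, B z = 1 := by
    simp only [hB]
    rw [Finset.sum_comm]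
    simp only [← Finset.mul_sum, hP1, mul_one, hq1]
  have hl : ∑ ω, q ω * ∑ z, P ω z * R z - ∑ z, U z * R z = ∑ z, (B z - U z) * R z := by
    simp only [hB, sub_mul, Finset.sum_sub_distrib, Finset.sum_mul, Finset.mul_sum, mul_assoc]
    rw [Finset.sum_comm]
  have hr : ∑ ω', q ω' * ∑ ω, q ω * ∑ z, P ω z * P ω' z / U z = ∑ z, B z ^ 2 / U z := by
    simp only [hB, sq, Finset.sum_mul, Finset.mul_sum, Finset.sum_div]
    rw [Finset.sum_comm' (t' := Finset.univ) (s' := fun _ => Finset.univ) (by simp)]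
    conv_rhs => rw [Finset.sum_comm]
    refine Finset.sum_congr rfl fun ω _ => ?_
    rw [Finset.sum_comm]
    refine Finset.sum_congr rfl fun z _ => Finset.sum_congr rfl fun ω' _ => ?_
    ring
  have hc : ∑ z, (B z - U z) ^ 2 / U z = ∑ z, B z ^ 2 / U z - 1 := by
    have : ∀ z, (B z - U z) ^ 2 / U z = B z ^ 2 / U z - 2 * B z + U z := fun z => by
      by_cases h : U z = 0
      · simp [h, hB0 z h]
      · field_simp
        ring
    simp only [this, Finset.sum_add_distrib, Finset.sum_sub_distrib, ← Finset.mul_sum, hB1, hU1]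
    ring
  rw [hl, hr, ← hc]
  -- Second factor in Cauchy–Schwarz, with `(B - U) * R` split as `(B - U) / √U` times `√U * R`.
  have hg : ∑ z, U z * R z ^ 2 ≤ 1 := by
    rw [← hU1]
    refine Finset.sum_le_sum fun z _ => ?_
    have := pow_le_one₀ (n := 2) (hR z).1 (hR z).2
    nlinarith [hU z]
  have hf0 : ∀ z, 0 ≤ (B z - U z) ^ 2 / U z := fun z => div_nonneg (sq_nonneg _) (hU z)
  refine (Finset.sum_sq_le_sum_mul_sum_of_sq_le_mul Finset.univ (fun z _ => hf0 z)
    (fun z _ => mul_nonneg (hU z) (sq_nonneg (R z))) fun z _ => ?_).trans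
    (mul_le_of_le_one_right (Finset.sum_nonneg fun z _ => hf0 z) hg)
  by_cases h : U z = 0
  · simp [h, hB0 z h]
  · refine le_of_eq ?_
    field_simp

end ChiSquare

/-! ### Paired perturbations of uniform and their images under channels. -/

section Perturbation

variable {k : ℕ}

/-- The perturbation of the uniform distribution that moves mass `γ * x i / k` from the second to
the first element of the `i`-th pair. -/
noncomputable def perturb (γ : ℝ) (x : Fin (k / 2) → ℝ) (a : Fin k) : ℝ :=
  -- The default `0` is reached only by the last, unpaired element when `k` is odd.
  (1 + (if a.1 % 2 = 0 then γ else -γ) * if h : a.1 / 2 < k / 2 then x ⟨a.1 / 2, h⟩ else 0) / k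

lemma perturb_pairFst (γ : ℝ) (x : Fin (k / 2) → ℝ) (i : Fin (k / 2)) :
    perturb γ x (pairFst i) = (1 + γ * x i) / k := by
  simp [perturb, pairFst]

lemma perturb_pairSnd (γ : ℝ) (x : Fin (k / 2) → ℝ) (i : Fin (k / 2)) :
    perturb γ x (pairSnd i) = (1 - γ * x i) / k := by
  have h : (2 * i.1 + 1) / 2 = i.1 := by omega
  have h' : (2 * i.1 + 1) % 2 = 1 := by omega
  simp [perturb, pairSnd, h, h']
  ring

lemma sum_eq_sum_pairs (hk : Even k) (f : Fin k → ℝ) :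
    ∑ a, f a = ∑ i, (f (pairFst i) + f (pairSnd i)) := by
  have h2 : k % 2 = 0 := Nat.even_iff.1 hk
  have hbij : Function.Bijective fun p : Fin (k / 2) × Bool =>
      if p.2 then pairFst p.1 else pairSnd p.1 := by
    refine ⟨?_, fun a => ?_⟩
    · rintro ⟨i, s⟩ ⟨j, t⟩ h
      have hv := congrArg Fin.val h
      cases s <;> cases t <;> simp [pairFst, pairSnd] at hv <;> first | omega | simp [Fin.ext_iff, hv]
    · have ha := a.2
      by_cases h : a.1 % 2 = 0
      · exact ⟨(⟨a.1 / 2, by omega⟩, true), Fin.ext (by simp [pairFst]; omega)⟩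
      · exact ⟨(⟨a.1 / 2, by omega⟩, false), Fin.ext (by simp [pairSnd]; omega)⟩
  rw [← (Equiv.ofBijective _ hbij).sum_comp, Fintype.sum_prod_type]
  simp

lemma perturb_mem_stdSimplex (hk : Even k) (hk0 : 0 < k) {γ : ℝ} (hγ : 0 ≤ γ) (hγ1 : γ ≤ 1)
    {x : Fin (k / 2) → ℝ} (hx : ∀ i, |x i| ≤ 1) : perturb γ x ∈ stdSimplex ℝ (Fin k) := by
  have hk' : (0 : ℝ) < k := by exact_mod_cast hk0
  constructor
  · intro a
    refine div_nonneg ?_ hk'.le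
    have h1 : |if a.1 % 2 = 0 then γ else -γ| ≤ 1 := by
      split_ifs <;> simpa [abs_of_nonneg hγ] using hγ1
    have h2 : |if h : a.1 / 2 < k / 2 then x ⟨a.1 / 2, h⟩ else 0| ≤ 1 := by
      split_ifs
      · exact hx _
      · simp
    have h3 := mul_le_one₀ h1 (abs_nonneg _) h2
    rw [← abs_mul] at h3
    linarith [(abs_le.1 h3).1]
  · rw [sum_eq_sum_pairs hk]
    have h1 : ∑ _a : Fin k, (1 : ℝ) / k = 1 := by
      rw [Finset.sum_const, Finset.card_univ, Fintype.card_fin, nsmul_eq_mul]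
      field_simp
    rw [← h1, sum_eq_sum_pairs hk]
    refine Finset.sum_congr rfl fun i _ => ?_
    rw [perturb_pairFst, perturb_pairSnd]
    ring

/-- The distance is `γ / k` times the `ℓ¹` norm of `x`, and `x i ^ 2 ≤ |x i|` on the cube. The
squared norm is what the walk controls. -/
lemma tvDist_perturb_ge (hk : Even k) {γ : ℝ} (hγ : 0 ≤ γ)
    {x : EuclideanSpace ℝ (Fin (k / 2))} (hx : ∀ i, |x i| ≤ 1) :
    γ * ‖x‖ ^ 2 / k ≤ tvDist (perturb γ x) (uniform k) := by
  rw [tvDist, sum_eq_sum_pairs hk, EuclideanSpace.real_norm_sq_eq, Finset.mul_sum, Finset.mul_sum,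
    Finset.sum_div]
  refine Finset.sum_le_sum fun i _ => ?_
  simp only [perturb_pairFst, perturb_pairSnd, uniform]
  rw [← sub_div, ← sub_div, add_sub_cancel_left,
    sub_sub_cancel_left, neg_div, abs_neg, abs_div, abs_mul, abs_of_nonneg hγ, Nat.abs_cast]
  have h : x i ^ 2 ≤ |x i| := by
    rw [← sq_abs]
    nlinarith [hx i, abs_nonneg (x i)]
  calc _ ≤ γ * |x i| / k := by gcongr
    _ = _ := by ring

variable {Y : Type v} [Fintype Y]

/-- The law of the message sent through `W` on a sample from `p`. -/
noncomputable def output (W : Fin k → Y → ℝ) (p : Fin k → ℝ) (y : Y) : ℝ := ∑ x, p x * W x y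

lemma output_nonneg {W : Fin k → Y → ℝ} (hW : IsChannel W) {p : Fin k → ℝ} (hp : ∀ x, 0 ≤ p x)
    (y : Y) : 0 ≤ output W p y :=
  Finset.sum_nonneg fun x _ => mul_nonneg (hp x) (channel_nonneg hW x y)

lemma sum_output {W : Fin k → Y → ℝ} (hW : IsChannel W) {p : Fin k → ℝ}
    (hp : p ∈ stdSimplex ℝ (Fin k)) : ∑ y, output W p y = 1 := by
  simp only [output]
  rw [Finset.sum_comm]
  simp [← Finset.mul_sum, (hW _).2, hp.2]

omit [Fintype Y] in
lemma output_uniform (W : Fin k → Y → ℝ) (y : Y) :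
    output W (uniform k) y = (∑ x, W x y) / k := by
  simp only [output, uniform]
  rw [← Finset.mul_sum]
  ring

omit [Fintype Y] in
lemma output_perturb (hk : Even k) (W : Fin k → Y → ℝ) (γ : ℝ) (x : Fin (k / 2) → ℝ) (y : Y) :
    output W (perturb γ x) y =
      (∑ x, W x y + γ * ∑ i, x i * (W (pairFst i) y - W (pairSnd i) y)) / k := by
  rw [output, sum_eq_sum_pairs hk, sum_eq_sum_pairs hk, Finset.mul_sum, ← Finset.sum_add_distrib,
    Finset.sum_div]
  refine Finset.sum_congr rfl fun i _ => ?_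
  rw [perturb_pairFst, perturb_pairSnd]
  ring

lemma output_eq_zero (hk0 : 0 < k) {W : Fin k → Y → ℝ} (hW : IsChannel W) {y : Y}
    (h : output W (uniform k) y = 0) (p : Fin k → ℝ) : output W p y = 0 := by
  have hk' : (k : ℝ) ≠ 0 := by exact_mod_cast hk0.ne'
  rw [output_uniform, div_eq_zero_iff, or_iff_left hk'] at h
  simp [output, channel_eq_zero_of_sum_eq_zero hW h]

/-- The terms linear in `γ` vanish because every row of a channel has sum one; the quadratic term is
the form defined by `H W`. -/
lemma sum_output_perturb_mul_div (hk : Even k) (hk0 : 0 < k) {W : Fin k → Y → ℝ}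
    (hW : IsChannel W) (γ : ℝ) (x x' : Fin (k / 2) → ℝ) :
    ∑ y, output W (perturb γ x) y * output W (perturb γ x') y / output W (uniform k) y =
      1 + γ ^ 2 / k * (x ⬝ᵥ (H W).mulVec x') := by
  have hk' : (k : ℝ) ≠ 0 := by exact_mod_cast hk0.ne'
  have h1 : ∑ y, ∑ x, W x y = k := by
    rw [Finset.sum_comm]
    simp [(hW _).2]
  have h2 : ∀ x : Fin (k / 2) → ℝ, ∑ y, ∑ i, x i * (W (pairFst i) y - W (pairSnd i) y) = 0 :=
    fun x => by
      rw [Finset.sum_comm]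
      simp [← Finset.mul_sum, Finset.sum_sub_distrib, (hW _).2]
  have h3 : ∀ y, output W (perturb γ x) y * output W (perturb γ x') y / output W (uniform k) y =
      (∑ x, W x y) / k + γ / k * (∑ i, x i * (W (pairFst i) y - W (pairSnd i) y)) +
      γ / k * (∑ i, x' i * (W (pairFst i) y - W (pairSnd i) y)) +
      γ ^ 2 / k * ((∑ i, x i * (W (pairFst i) y - W (pairSnd i) y)) *
        (∑ i, x' i * (W (pairFst i) y - W (pairSnd i) y)) / ∑ x, W x y) := fun y => by
    rw [output_perturb hk, output_perturb hk, output_uniform]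
    by_cases h : ∑ x, W x y = 0
    · simp [channel_eq_zero_of_sum_eq_zero hW h]
    · field_simp
      ring
  simp only [h3, Finset.sum_add_distrib, ← Finset.mul_sum, ← Finset.sum_div, h2]
  rw [h1, dotProduct_H_mulVec, div_self hk']
  ring

end Perturbation

/-! ### The lower bound for fixed channels and for private coins. -/

section LowerBound

variable {k n : ℕ} {Y : Type v} [Fintype Y]

/-- The sum factorizes over players, and `1 + a ≤ exp a` in each factor gathers the matrices into
their sum in the exponent. -/
lemma chiSquare_prod_output_le (hk : Even k) (hk0 : 0 < k) {W : Fin n → Fin k → Y → ℝ}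
    (hW : ∀ i, IsChannel (W i)) {γ : ℝ} (hγ : 0 ≤ γ) (hγ1 : γ ≤ 1)
    {x x' : EuclideanSpace ℝ (Fin (k / 2))} (hx : ∀ i, |x i| ≤ 1) (hx' : ∀ i, |x' i| ≤ 1) :
    ∑ y : Fin n → Y, (∏ i, output (W i) (perturb γ x) (y i)) *
        (∏ i, output (W i) (perturb γ x') (y i)) / ∏ i, output (W i) (uniform k) (y i) ≤
      Real.exp (inner ℝ x ((γ ^ 2 / k) • Matrix.toEuclideanLin (∑ i, H (W i)) x')) := by
  simp only [← Finset.prod_mul_distrib, ← Finset.prod_div_distrib]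
  rw [sum_pi_prod fun i y => output (W i) (perturb γ x) y * output (W i) (perturb γ x') y /
    output (W i) (uniform k) y]
  have hin : inner ℝ x ((γ ^ 2 / k) • Matrix.toEuclideanLin (∑ i, H (W i)) x') =
      ∑ i, γ ^ 2 / k * (x.ofLp ⬝ᵥ (H (W i)).mulVec x'.ofLp) := by
    rw [← Finset.mul_sum, ← dotProduct_sum, ← Matrix.sum_mulVec, inner_smul_right,
      Matrix.toLpLin_apply]
    simp only [PiLp.inner_apply, dotProduct, RCLike.inner_apply, conj_trivial, mul_comm]
  rw [hin, Real.exp_sum]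
  refine Finset.prod_le_prod (fun i _ => Finset.sum_nonneg fun y _ => ?_) fun i _ => ?_
  · have h1 := (perturb_mem_stdSimplex hk hk0 hγ hγ1 hx).1
    have h2 := (perturb_mem_stdSimplex hk hk0 hγ hγ1 hx').1
    exact div_nonneg (mul_nonneg (output_nonneg (hW i) h1 y) (output_nonneg (hW i) h2 y))
      (output_nonneg (hW i) (fun _ => by simp [uniform]) y)
  · rw [sum_output_perturb_mul_div hk hk0 (hW i)]
    linarith [Real.add_one_le_exp (γ ^ 2 / k * (x.ofLp ⬝ᵥ (H (W i)).mulVec x'.ofLp))]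

lemma uniform_mem_stdSimplex (hk0 : 0 < k) : uniform k ∈ stdSimplex ℝ (Fin k) := by
  have hk' : (k : ℝ) ≠ 0 := by exact_mod_cast hk0.ne'
  refine ⟨fun _ => by simp [uniform], ?_⟩
  simp [uniform, hk']

/-- A uniformity test from the messages of `n` fixed channels needs the channels to have large
total trace of `H`. -/
theorem le_sum_trace_H_of_test (hk : Even k) (hk0 : 0 < k) {W : Fin n → Fin k → Y → ℝ}
    (hW : ∀ i, IsChannel (W i)) {ε : ℝ} (hε : 0 < ε) (hε1 : ε < 1 / (12 * √2))
    {T : (Fin n → Y) → ℝ} (hT : ∀ y, T y ∈ Set.Icc (0 : ℝ) 1)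
    (hacc : 11 / 12 < ∑ y, (∏ i, output (W i) (uniform k) (y i)) * T y)
    (hrej : ∀ p ∈ stdSimplex ℝ (Fin k), ε < tvDist p (uniform k) →
      11 / 12 < ∑ y, (∏ i, output (W i) p (y i)) * (1 - T y)) :
    1 / 100000 * (√(k : ℝ) / ε ^ 2 * k) ≤ ∑ i, (H (W i)).trace := by
  by_contra! hlt
  set τ : ℝ := 1 / 100000 * (√(k : ℝ) / ε ^ 2 * k) with hτdef
  have hk' : (0 : ℝ) < k := by exact_mod_cast hk0
  have h2k : 2 * (k / 2) = k := Nat.two_mul_div_two_of_even hk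
  have hm : (k : ℝ) = 2 * ((k / 2 : ℕ) : ℝ) := by exact_mod_cast h2k.symm
  have hm0 : (0 : ℝ) < ((k / 2 : ℕ) : ℝ) := by linarith
  have : Nonempty (Fin (k / 2)) := ⟨⟨0, by omega⟩⟩
  have hτ : 0 < τ := by positivity
  have hA : (∑ i, H (W i)).PosSemidef := Matrix.posSemidef_sum _ fun i _ => H_posSemidef (hW i)
  obtain ⟨L, hL, hcontr⟩ := exists_submodule_norm_mulVec_le hA hτ
    (by rw [Matrix.trace_sum]; exact hlt.le)
  obtain ⟨Ω, _, q, X, hq, hq1, hXL, hX1, hexp, hsq⟩ := exists_subgaussian_of_finrank_ge L hL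
  rw [Fintype.card_fin] at hsq hcontr
  set m : ℝ := ((k / 2 : ℕ) : ℝ)
  -- The hypothesis on `ε` gives `γ ≤ 1`, and `γ / 16 > ε` because `√2 > 4 / 3`.
  set γ : ℝ := 12 * √2 * ε with hγdef
  have h2 : √(2 : ℝ) ^ 2 = 2 := Real.sq_sqrt (by norm_num)
  have hs2 : 4 / 3 < √(2 : ℝ) := Real.lt_sqrt_of_sq_lt (by norm_num)
  have hγ : 0 < γ := by positivity
  have hγ1 : γ ≤ 1 := by
    rw [lt_div_iff₀ (by positivity)] at hε1
    linarith
  have hγ2 : γ ^ 2 = 288 * ε ^ 2 := by rw [hγdef, mul_pow, mul_pow, h2]; ring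
  have hmem := fun ω => perturb_mem_stdSimplex hk hk0 hγ.le hγ1 (hX1 ω)
  have hXm : ∀ ω, ‖X ω‖ ^ 2 ≤ m := fun ω => by
    rw [EuclideanSpace.real_norm_sq_eq]
    calc _ ≤ ∑ _i : Fin (k / 2), (1 : ℝ) := Finset.sum_le_sum fun i _ => by
          rw [← sq_abs]
          exact pow_le_one₀ (abs_nonneg _) (hX1 ω i)
      _ = m := by simp [m]
  set R : (Fin n → Y) → ℝ := fun y => 1 - T y
  have hR : ∀ y, R y ∈ Set.Icc (0 : ℝ) 1 := fun y =>
    ⟨sub_nonneg.2 (hT y).2, sub_le_self _ (hT y).1⟩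
  set P : Ω → (Fin n → Y) → ℝ := fun ω y => ∏ i, output (W i) (perturb γ (X ω)) (y i)
  set U : (Fin n → Y) → ℝ := fun y => ∏ i, output (W i) (uniform k) (y i)
  have hU1 : ∑ y, U y = 1 := by
    rw [sum_pi_prod fun i y => output (W i) (uniform k) y]
    exact Finset.prod_eq_one fun i _ => sum_output (hW i) (uniform_mem_stdSimplex hk0)
  have hchi := sq_sub_le_chiSquare (q := q) (P := P) (U := U) (R := R) hq1
    (fun ω => by
      rw [sum_pi_prod fun i y => output (W i) (perturb γ (X ω)) y]
      exact Finset.prod_eq_one fun i _ => sum_output (hW i) (hmem ω))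
    (fun y => Finset.prod_nonneg fun i _ =>
      output_nonneg (hW i) (uniform_mem_stdSimplex hk0).1 _) hU1
    (fun ω y hy => by
      obtain ⟨i, hi, h⟩ := Finset.prod_eq_zero_iff.1 hy
      exact Finset.prod_eq_zero hi (output_eq_zero hk0 (hW i) h _)) hR
  have hupper : ∑ ω', q ω' * ∑ ω, q ω * ∑ y, P ω y * P ω' y / U y ≤ Real.exp (1 / 32) := by
    calc _ ≤ ∑ ω', q ω' * Real.exp (1 / 32) := by
          refine Finset.sum_le_sum fun ω' _ => mul_le_mul_of_nonneg_left ?_ (hq ω')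
          set v := (γ ^ 2 / k) • Matrix.toEuclideanLin (∑ i, H (W i)) (X ω')
          -- In `γ ^ 2 * τ` the `ε` cancels. With `‖X ω'‖ ^ 2 ≤ m` and `k = 2 * m`, an absolute
          -- constant remains. Sub-Gaussianity is then applied to `X ω` with `ω'` fixed.
          have hv : ‖v‖ ^ 2 ≤ 1 / 40 := by
            have hnorm : ‖v‖ ≤ γ ^ 2 / k * (8 * τ / m * ‖X ω'‖) := by
              rw [norm_smul, Real.norm_of_nonneg (by positivity)]
              gcongr
              exact hcontr _ (hXL ω')
            have hcoef : γ ^ 2 / k * (8 * τ / m) = 288 * 8 / 100000 * √(k : ℝ) / m := by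
              rw [hγ2, hτdef]
              field_simp
            calc ‖v‖ ^ 2 ≤ (γ ^ 2 / k * (8 * τ / m * ‖X ω'‖)) ^ 2 := by gcongr
              _ = (288 * 8 / 100000) ^ 2 * √(k : ℝ) ^ 2 / m ^ 2 * ‖X ω'‖ ^ 2 := by
                rw [← mul_assoc, hcoef]
                ring
              _ ≤ (288 * 8 / 100000) ^ 2 * √(k : ℝ) ^ 2 / m ^ 2 * m := by
                gcongr
                exact hXm ω'
              _ ≤ 1 / 40 := by
                rw [Real.sq_sqrt hk'.le, hm]
                field_simp
                norm_num
          calc _ ≤ ∑ ω, q ω * Real.exp (inner ℝ (X ω) v) :=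
                Finset.sum_le_sum fun ω _ => mul_le_mul_of_nonneg_left
                  (chiSquare_prod_output_le hk hk0 hW hγ.le hγ1 (hX1 ω) (hX1 ω')) (hq ω)
            _ ≤ Real.exp (5 / 4 * ‖v‖ ^ 2) := hexp v
            _ ≤ _ := Real.exp_le_exp.2 (by linarith)
      _ = _ := by rw [← Finset.sum_mul, hq1, one_mul]
  have hexp32 : Real.exp (1 / 32) ≤ 1 + 1 / 16 := by
    have := Real.abs_exp_sub_one_le (x := 1 / 32) (by norm_num [abs_of_pos])
    rw [abs_of_pos (by norm_num : (0 : ℝ) < 1 / 32)] at this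
    linarith [le_abs_self (Real.exp (1 / 32) - 1)]
  have hURej : ∑ y, U y * R y < 1 / 12 := by
    have : ∑ y, U y * R y = 1 - ∑ y, U y * T y := by
      simp only [R, mul_sub, mul_one, Finset.sum_sub_distrib, hU1]
    linarith
  have hPRej : 11 / 32 ≤ ∑ ω, q ω * ∑ y, P ω y * R y := by
    -- A lower bound affine in `‖X ω‖ ^ 2` can be averaged directly: it is nonpositive when `X ω` is
    -- too short for the test to be obliged to reject, and at most `11 / 12` otherwise.
    have hω : ∀ ω, 11 / 12 * (‖X ω‖ ^ 2 / m - 1 / 8) ≤ ∑ y, P ω y * R y := fun ω => by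
      have h1 : ‖X ω‖ ^ 2 / m ≤ 1 := (div_le_one hm0).2 (hXm ω)
      by_cases h : ‖X ω‖ ^ 2 / m ≤ 1 / 8
      · refine le_trans (by linarith) (Finset.sum_nonneg fun y _ => mul_nonneg
          (Finset.prod_nonneg fun i _ => output_nonneg (hW i) (hmem ω).1 _) (hR y).1)
      · refine le_trans (by linarith) (hrej _ (hmem ω) ?_).le
        refine lt_of_lt_of_le ?_ (tvDist_perturb_ge hk hγ.le (hX1 ω))
        have h3 : γ * ‖X ω‖ ^ 2 / k = γ / 2 * (‖X ω‖ ^ 2 / m) := by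
          rw [hm]
          field_simp
        rw [h3]
        push Not at h
        calc ε < γ / 2 * (1 / 8) := by rw [hγdef]; nlinarith
          _ ≤ _ := by gcongr
    calc (11 / 32 : ℝ) ≤ 11 / 12 * ((∑ ω, q ω * ‖X ω‖ ^ 2) / m - 1 / 8) := by
          have : 1 / 2 ≤ (∑ ω, q ω * ‖X ω‖ ^ 2) / m := (le_div_iff₀ hm0).2 hsq
          linarith
      _ = ∑ ω, q ω * (11 / 12 * (‖X ω‖ ^ 2 / m - 1 / 8)) := by
          have : ∀ ω, q ω * (11 / 12 * (‖X ω‖ ^ 2 / m - 1 / 8)) =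
            11 / 12 / m * (q ω * ‖X ω‖ ^ 2) - 11 / 96 * q ω := fun ω => by ring
          simp only [this, Finset.sum_sub_distrib, ← Finset.mul_sum, hq1]
          ring
      _ ≤ _ := Finset.sum_le_sum fun ω _ => mul_le_mul_of_nonneg_left (hω ω) (hq ω)
  -- The rejection probabilities differ by more than `11 / 32 - 1 / 12 = 25 / 96`, whose square
  -- exceeds `1 / 16`.
  nlinarith

omit [Fintype Y] in
-- Independence of the seeds factorizes the integral; a seed shared by the players would not allow
-- this.
lemma messageProb_eq_prod_output {𝓦 : Set (Fin k → Y → ℝ)} (P : Protocol.{v, w} 𝓦 n)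
    (p : Fin k → ℝ) (y : Fin n → Y) :
    P.messageProb p y = ∏ i, output (meanChannel (P.μ i) (P.channel i)) p (y i) := by
  simp only [output]
  rw [← sum_pi_prod fun i x => p x * meanChannel (P.μ i) (P.channel i) x (y i)]
  refine Finset.sum_congr rfl fun x _ => ?_
  rw [Finset.prod_mul_distrib,
    integral_fintype_prod_eq_prod fun i u => P.channel i u (x i) (y i)]
  rfl

lemma le_toENNReal_iInf_natCast {p : ℕ → Prop} {a : ℝ≥0∞} (h : ∀ n, p n → a ≤ n) :
    a ≤ ((⨅ (n : ℕ) (_ : p n), (n : ℕ∞) : ℕ∞) : ℝ≥0∞) := by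
  classical
  by_cases hp : ∃ n, p n
  · have h1 : ((Nat.find hp : ℕ) : ℕ∞) ≤ ⨅ (n : ℕ) (_ : p n), (n : ℕ∞) :=
      le_iInf₂ fun n hn => by exact_mod_cast Nat.find_min' hp hn
    exact (h _ (Nat.find_spec hp)).trans (by simpa using ENat.toENNReal_mono h1)
  · push Not at hp
    simp [hp]

theorem ofReal_le_mul_maxNuclear_of_test (hk : Even k) (hk0 : 0 < k) {𝓦 : Set (Fin k → Y → ℝ)}
    (h𝓦 : ∀ W ∈ 𝓦, IsChannel W) {ε : ℝ} (hε : 0 < ε) (hε1 : ε < 1 / (12 * √2))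
    {P : Protocol.{v, w} 𝓦 n} {T : (Fin n → Y) → ℝ} (hT : IsUniformityTest ε P T) :
    ENNReal.ofReal (1 / 100000 * (√(k : ℝ) / ε ^ 2 * k)) ≤ n * maxNuclear 𝓦 := by
  obtain ⟨hT01, hacc, hrej⟩ := hT
  simp only [messageProb_eq_prod_output] at hacc hrej
  have hV : ∀ i u, IsChannel (P.channel i u) := fun i u => h𝓦 _ (P.channel_mem i u)
  have h := le_sum_trace_H_of_test hk hk0
    (fun i => isChannel_meanChannel (μ := P.μ i) (hV i) (P.measurable_channel i)) hε hε1 hT01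
    hacc hrej
  calc _ ≤ ENNReal.ofReal (∑ i, (H (meanChannel (P.μ i) (P.channel i))).trace) :=
        ENNReal.ofReal_le_ofReal h
    _ = ∑ i, ENNReal.ofReal (H (meanChannel (P.μ i) (P.channel i))).trace :=
        ENNReal.ofReal_sum_of_nonneg fun i _ => (H_posSemidef <|
          isChannel_meanChannel (hV i) (P.measurable_channel i)).trace_nonneg
    _ ≤ ∑ _i : Fin n, maxNuclear 𝓦 := Finset.sum_le_sum fun i _ =>
        ofReal_trace_H_meanChannel_le h𝓦 (P.channel_mem i) (P.measurable_channel i)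
    _ = _ := by simp

end LowerBound

end PrivateCoin

theorem mainTheorem1 :
    ∃ c : ℝ, 0 < c ∧
      ∀ (k : ℕ), Even k → 0 < k →
      ∀ (Y : Type v) [Fintype Y] (𝓦 : Set (Fin k → Y → ℝ)), (∀ W ∈ 𝓦, PrivateCoin.IsChannel W) →
      ∀ ε : ℝ, 0 < ε → ε < 1 / (12 * √2) →
        ENNReal.ofReal c *
            (ENNReal.ofReal (√(k : ℝ) / ε ^ 2) * ((k : ℝ≥0∞) / PrivateCoin.maxNuclear 𝓦)) ≤
          (PrivateCoin.sampleComplexity.{v, w} 𝓦 ε : ℝ≥0∞) := by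
  refine ⟨1 / 100000, by norm_num, fun k hk hk0 Y _ 𝓦 h𝓦 ε hε hε1 => ?_⟩
  refine PrivateCoin.le_toENNReal_iInf_natCast ?_
  rintro n ⟨P, T, hT⟩
  have h := PrivateCoin.ofReal_le_mul_maxNuclear_of_test hk hk0 h𝓦 hε hε1 hT
  rw [ENNReal.ofReal_mul (by norm_num), ENNReal.ofReal_mul (by positivity),
    ENNReal.ofReal_natCast] at h
  rw [← mul_div_assoc, ← mul_div_assoc]
  -- If `maxNuclear 𝓦` is `0`, then `h` bounds a positive quantity by `0`, so no test exists, in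
  -- agreement with a quotient equal to `⊤`.
  exact ENNReal.div_le_of_le_mul h
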